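/- Let $a>0$ and $T>0$, and assume the following. (i) $\Phi:[-a,a]\to\mathbb{R}$ is continuous on $[-a,a]$ and $C^1$ on $(-a,a)$, and $\phi:=\Phi'$ is an increasing homeomorphism of $(-a,a)$ onto $\mathbb{R}$ with $\phi(0)=0$. (ii) (Strong resonance.) $f:[0,T]\times\mathbb{R}\to\mathbb{R}$ is continuous, and, with $F(t,\tau)=\int_0^\tau f(t,s)\,ds$, there is a constant $\alpha\in\mathbb{R}$ such that $f(t,s)\to 0$ and $F(t,s)\to\alpha$ as $|s|\to\infty$, both uniformly with respect to $t\in[0,T]$. (iii) $h:[0,T]\to\mathbb{R}$ is continuous and $\int_0^T h(t)\,dt=0$. Then the periodic problem $$(\phi(u'(t)))'=f(t,u(t))+h(t)\ \text{ in }(0,T),\qquad u(0)=u(T),\quad u'(0)=u'(T),$$ has at least one solution, that is, a function $u\in C^1[0,T]$ with $u(0)=u(T)$, $u'(0)=u'(T)$ and $\|u'\|_\infty<a$, such that $\phi\circ u'$ is absolutely continuous on $[0,T]$ and $(\phi(u'(t)))'=f(t,u(t))+h(t)$ for almost every $t\in(0,T)$. Moreover, the relativistic operator is the special case $a=1$,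 $\Phi(s)=1-\sqrt{1-s^2}$: this $\Phi$ satisfies (i), and $\phi(s)=s/\sqrt{1-s^2}$ for $s\in(-1,1)$. -/

import Mathlib

open Set Filter Topology MeasureTheory

/-- The assumption on the operator: `Φ` is continuous on `[-a, a]` and `C¹` on `(-a, a)`, and its derivative
`φ = Φ'` is an increasing homeomorphism of `(-a, a)` onto `ℝ` with `φ 0 = 0`.
The values of `Φ` outside `[-a, a]` play no role. -/
structure HypPhi (a : ℝ) (Φ : ℝ → ℝ) : Prop where
  continuousOn : ContinuousOn Φ (Icc (-a) a)
  contDiffOn : ContDiffOn ℝ 1 Φ (Ioo (-a) a)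
  strictMonoOn : StrictMonoOn (deriv Φ) (Ioo (-a) a)
  isHomeomorph : IsHomeomorph ((Ioo (-a) a).domRestrict (deriv Φ))
  map_zero : deriv Φ 0 = 0

/-- The primitive `F(t, τ) = ∫₀^τ f(t, s) ds`. -/
noncomputable def primitive (f : ℝ → ℝ → ℝ) (t τ : ℝ) : ℝ := ∫ s in (0 : ℝ)..τ, f t s

/-- Strong resonance: `f` is continuous on `[0, T] × ℝ`, and, uniformly in
`t ∈ [0, T]`, `f(t, s) → 0` and `F(t, s) → α` as `|s| → ∞`, for some real `α`. -/
structure StrongResonance (T : ℝ) (f : ℝ → ℝ → ℝ) : Prop where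
  continuousOn : ContinuousOn (fun p : ℝ × ℝ => f p.1 p.2) (Icc 0 T ×ˢ univ)
  tendsto_zero : TendstoUniformlyOn (fun s t => f t s) (fun _ => 0)
    (comap (fun s : ℝ => |s|) atTop) (Icc 0 T)
  tendsto_primitive : ∃ α : ℝ, TendstoUniformlyOn (fun s t => primitive f t s) (fun _ => α)
    (comap (fun s : ℝ => |s|) atTop) (Icc 0 T)

/-- `u` is a solution of `(φ(u'))' = f(t, u) + h(t)` on `(0, T)`, `φ = Φ'`, with
`u 0 = u T` and `u' 0 = u' T`. Only the values of `u` on `[0, T]` matter: `u'` is the derivative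
relative to `[0, T]`, one-sided at the end points. -/
structure IsPeriodicSolution (a T : ℝ) (Φ : ℝ → ℝ) (f : ℝ → ℝ → ℝ) (h u : ℝ → ℝ) : Prop where
  contDiffOn : ContDiffOn ℝ 1 u (Icc 0 T)
  periodic : u 0 = u T
  periodic_deriv : derivWithin u (Icc 0 T) 0 = derivWithin u (Icc 0 T) T
  /-- `‖u'‖_∞ < a`. -/
  sup_deriv_lt : ∃ b < a, ∀ t ∈ Icc 0 T, |derivWithin u (Icc 0 T) t| ≤ b
  absolutelyContinuous :
    AbsolutelyContinuousOnInterval (fun t => deriv Φ (derivWithin u (Icc 0 T) t)) 0 T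
  equation : ∀ᵐ t ∂volume.restrict (Ioo 0 T),
    HasDerivAt (fun r => deriv Φ (derivWithin u (Icc 0 T) r)) (f t (u t) + h t) t

/-!
The theorem is proved by a minimax argument for the action functional
`I(u) = ∫ Φ(u') + F(t, u) + h u` over periodic functions, written in the variables `r = u(0)` and
`p = u'`, so that `u(t) = r + ∫₀ᵗ p` with `∫ p = 0`.

Since `f` is bounded, `φ(u')` is a priori bounded along a solution. Hence `φ` may be replaced by a
globally defined monotone function (`exists_resonantProblem`), and the slopes `p` may be confined to
a convex compact subset of `C([0, T])` (`ResonantProblem.slopes`). For a given state, freeze the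
right-hand side `f(t, u) + h`, with primitive `E`. The convex functional `p ↦ ∫ (Φ(p) - E p)` has a
unique minimizer of integral zero, `φ⁻¹(c + E)`. The descent step moves `p` toward this minimizer and
`r` against `∫ f(t, u)`. It preserves the admissible states by convexity, and lowers `I` at a rate at
least the `gap`, up to a uniformly small error; the gap is a continuous nonnegative function of the
state which vanishes only at solutions
(`ResonantProblem.action_step_le`, `ResonantProblem.exists_critical`). Because the steps are convex
combinations, no gradient flow is needed.

Strong resonance destroys compactness at one level only: as `|r| → ∞`, `I - gap` tends uniformly to
`levelAtInfinity = α T + min_p ∫ (Φ(p) - H p)`, with `H` the primitive of `h`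
(`ResonantProblem.exists_far`), while for bounded `r` the states form a compact set
(`ResonantProblem.exists_gap_ge`). Hence a minimax level over a family of sets invariant under the
descent steps yields a zero of the gap, unless it is the level at infinity
(`ResonantProblem.exists_gap_eq_zero_of_minimax`). This is applied to points, where the level is
`inf I`, and to paths along which `r` goes from `-∞` to `∞`. If there were no solution, both
would equal the level at infinity. Since all such paths cross the compact set `r = 0`, there would be
states with `r = 0` at which `I` is arbitrarily close to `inf I` while the gap is bounded below; one
descent step from such a state would go below `inf I`
(`ResonantProblem.exists_gap_eq_zero`).
-/

/-! ### Integration on `C([0, T])` -/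

/-- The constant extension of a function on `[0, T]` to the real line. -/
noncomputable def extendConst {T : ℝ} [hT : Fact (0 < T)] (p : C(Icc (0 : ℝ) T, ℝ)) : ℝ → ℝ :=
  IccExtend hT.out.le p

/-- The primitive `t ↦ ∫₀ᵗ p` of a continuous function on `[0, T]`, as a linear map. -/
noncomputable def primLinear (T : ℝ) [hT : Fact (0 < T)] :
    C(Icc (0 : ℝ) T, ℝ) →ₗ[ℝ] C(Icc (0 : ℝ) T, ℝ) where
  toFun p :=
    { toFun := fun t => ∫ s in (0 : ℝ)..t, extendConst p s
      continuous_toFun := by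
        have hc : Continuous (extendConst p) := p.continuous.Icc_extend'
        exact (intervalIntegral.continuous_primitive
          (fun a b => hc.intervalIntegrable a b) 0).comp continuous_subtype_val }
  map_add' p q := by
    ext t
    exact intervalIntegral.integral_add (p.continuous.Icc_extend'.intervalIntegrable _ _)
      (q.continuous.Icc_extend'.intervalIntegrable _ _)
  map_smul' c p := by
    ext t
    exact intervalIntegral.integral_const_mul c (extendConst p)

section
variable {T : ℝ} [hT : Fact (0 < T)]

theorem continuous_extendConst (p : C(Icc (0 : ℝ) T, ℝ)) : Continuous (extendConst p) :=
  p.continuous.Icc_extend'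

theorem extendConst_apply (p : C(Icc (0 : ℝ) T, ℝ)) (t : Icc (0 : ℝ) T) :
    extendConst p t = p t :=
  IccExtend_val _ _ t

theorem abs_extendConst_le (p : C(Icc (0 : ℝ) T, ℝ)) (t : ℝ) : |extendConst p t| ≤ ‖p‖ :=
  p.norm_coe_le_norm _

theorem abs_primLinear_sub_le (p : C(Icc (0 : ℝ) T, ℝ)) (s t : Icc (0 : ℝ) T) :
    |primLinear T p s - primLinear T p t| ≤ ‖p‖ * |(s : ℝ) - t| := by
  have hi := fun a b => (continuous_extendConst p).intervalIntegrable (μ := volume) a b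
  change |(∫ r in (0 : ℝ)..s, extendConst p r) - ∫ r in (0 : ℝ)..t, extendConst p r| ≤ _
  rw [intervalIntegral.integral_interval_sub_left (hi _ _) (hi _ _)]
  exact intervalIntegral.norm_integral_le_of_norm_le_const (f := extendConst p)
    fun x _ => abs_extendConst_le p x

theorem primLinear_norm_le (p : C(Icc (0 : ℝ) T, ℝ)) : ‖primLinear T p‖ ≤ T * ‖p‖ := by
  refine (ContinuousMap.norm_le _ (by have := hT.out; positivity)).2 fun t => ?_
  have h := abs_primLinear_sub_le p t ⟨0, left_mem_Icc.2 hT.out.le⟩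
  have h0 : primLinear T p ⟨0, left_mem_Icc.2 hT.out.le⟩ = 0 :=
    intervalIntegral.integral_same
  rw [h0, sub_zero, sub_zero, abs_of_nonneg t.2.1] at h
  rw [Real.norm_eq_abs, mul_comm]
  exact h.trans (by gcongr; exact t.2.2)

end

/-- The primitive `t ↦ ∫₀ᵗ p` as a bounded operator on `C([0, T])`. -/
noncomputable def prim (T : ℝ) [Fact (0 < T)] :
    C(Icc (0 : ℝ) T, ℝ) →L[ℝ] C(Icc (0 : ℝ) T, ℝ) :=
  (primLinear T).mkContinuous T primLinear_norm_le

/-- The integral over `[0, T]` as a bounded functional on `C([0, T])`. -/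
noncomputable def total (T : ℝ) [hT : Fact (0 < T)] : C(Icc (0 : ℝ) T, ℝ) →L[ℝ] ℝ :=
  (ContinuousMap.evalCLM ℝ (⟨T, right_mem_Icc.2 hT.out.le⟩ : Icc (0 : ℝ) T)).comp (prim T)

section
variable {T : ℝ} [hT : Fact (0 < T)]

theorem prim_apply (p : C(Icc (0 : ℝ) T, ℝ)) (t : Icc (0 : ℝ) T) :
    prim T p t = ∫ s in (0 : ℝ)..t, extendConst p s := rfl

theorem total_apply (p : C(Icc (0 : ℝ) T, ℝ)) :
    total T p = ∫ s in (0 : ℝ)..T, extendConst p s := rfl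

theorem norm_prim_le (p : C(Icc (0 : ℝ) T, ℝ)) : ‖prim T p‖ ≤ T * ‖p‖ := primLinear_norm_le p

theorem abs_prim_sub_le (p : C(Icc (0 : ℝ) T, ℝ)) (s t : Icc (0 : ℝ) T) :
    |prim T p s - prim T p t| ≤ ‖p‖ * |(s : ℝ) - t| := abs_primLinear_sub_le p s t

theorem abs_total_le (p : C(Icc (0 : ℝ) T, ℝ)) : |total T p| ≤ T * ‖p‖ :=
  ((prim T p).norm_coe_le_norm _).trans (norm_prim_le p)

theorem total_const (c : ℝ) : total T (ContinuousMap.const _ c) = T * c := by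
  rw [total_apply]
  have : extendConst (T := T) (ContinuousMap.const _ c) = fun _ => c := rfl
  simp [this]

theorem total_const_mul (c : ℝ) (p : C(Icc (0 : ℝ) T, ℝ)) :
    total T (ContinuousMap.const _ c * p) = c * total T p := by
  have : ContinuousMap.const _ c * p = c • p := by ext; simp
  rw [this, map_smul, smul_eq_mul]

theorem total_mono {p q : C(Icc (0 : ℝ) T, ℝ)} (h : ∀ t, p t ≤ q t) : total T p ≤ total T q :=
  intervalIntegral.integral_mono hT.out.le
    ((continuous_extendConst p).intervalIntegrable _ _)
    ((continuous_extendConst q).intervalIntegrable _ _) fun _ => h _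

theorem total_nonneg {p : C(Icc (0 : ℝ) T, ℝ)} (h : ∀ t, 0 ≤ p t) : 0 ≤ total T p := by
  simpa using total_mono (p := 0) (q := p) (by simpa using h)

theorem total_lt {p q : C(Icc (0 : ℝ) T, ℝ)} (h : ∀ t, p t < q t) : total T p < total T q :=
  intervalIntegral.integral_lt_integral_of_continuousOn_of_le_of_exists_lt hT.out
    (continuous_extendConst p).continuousOn (continuous_extendConst q).continuousOn
    (fun _ _ => (h _).le) ⟨0, left_mem_Icc.2 hT.out.le, h _⟩

theorem eq_zero_of_total_eq_zero {p : C(Icc (0 : ℝ) T, ℝ)} (h : ∀ t, 0 ≤ p t)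
    (h0 : total T p = 0) : p = 0 := by
  by_contra hne
  obtain ⟨t, ht⟩ : ∃ t, p t ≠ 0 := by
    by_contra! hc
    exact hne (ContinuousMap.ext hc)
  have : total T 0 < total T p :=
    intervalIntegral.integral_lt_integral_of_continuousOn_of_le_of_exists_lt hT.out
      (continuous_extendConst 0).continuousOn (continuous_extendConst p).continuousOn
      (fun _ _ => h _) ⟨t, t.2, by
        rw [extendConst_apply, extendConst_apply]
        exact lt_of_le_of_ne (h t) ht.symm⟩
  rw [map_zero, h0] at this
  exact lt_irrefl _ this

theorem hasDerivAt_integral_extendConst (p : C(Icc (0 : ℝ) T, ℝ)) (t : ℝ) :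
    HasDerivAt (fun t => ∫ s in (0 : ℝ)..t, extendConst p s) (extendConst p t) t :=
  ((continuous_extendConst p).integral_hasStrictDerivAt 0 t).hasDerivAt

/-- Integration by parts against a function whose primitive vanishes at `T`. -/
theorem total_mul_prim (e : C(Icc (0 : ℝ) T, ℝ)) {p : C(Icc (0 : ℝ) T, ℝ)}
    (hp : total T p = 0) : total T (e * prim T p) = -total T (prim T e * p) := by
  have h := intervalIntegral.integral_mul_deriv_eq_deriv_mul (a := 0) (b := T)
    (fun t _ => hasDerivAt_integral_extendConst p t)
    (fun t _ => hasDerivAt_integral_extendConst e t)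
    ((continuous_extendConst p).intervalIntegrable _ _)
    ((continuous_extendConst e).intervalIntegrable _ _)
  rw [← total_apply p, hp, zero_mul, intervalIntegral.integral_same, zero_mul, sub_zero,
    zero_sub] at h
  rw [total_apply, total_apply]
  calc _ = _ := intervalIntegral.integral_congr fun t ht => ?_
    _ = _ := h
    _ = _ := congrArg _ (intervalIntegral.integral_congr fun t ht => ?_)
  all_goals
    rw [uIcc_of_le hT.out.le] at ht
    have ht' : projIcc 0 T hT.out.le t = ⟨t, ht⟩ := projIcc_of_mem _ ht
    simp [extendConst, IccExtend, ht', prim_apply, mul_comm]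

end

/-! ### The strongly resonant problem with a regularized operator -/

/-- The data of the periodic problem `(φ(u'))' = f(t, u) + h(t)` under strong resonance, with `φ`
replaced by a monotone function on the whole line. `θ` is the inverse of the original singular
operator; `φ` inverts `θ` only on `[-2TL, 2TL]`, where `L` bounds the right-hand side, and this is the
only range in which `φ(u')` takes values along the argument. -/
structure ResonantProblem (T : ℝ) [Fact (0 < T)] where
  /-- The inverse operator. -/
  θ : C(ℝ, ℝ)
  /-- The regularized operator. -/
  φ : C(ℝ, ℝ)
  /-- The nonlinearity. -/
  f : C(Icc (0 : ℝ) T × ℝ, ℝ)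
  /-- A primitive of the nonlinearity in the second variable. -/
  F : C(Icc (0 : ℝ) T × ℝ, ℝ)
  /-- The forcing term. -/
  h : C(Icc (0 : ℝ) T, ℝ)
  /-- A bound for the right-hand side. -/
  L : ℝ
  /-- The limit of the primitive at infinity. -/
  α : ℝ
  L_pos : 0 < L
  θ_strictMono : StrictMono θ
  θ_zero : θ 0 = 0
  φ_mono : Monotone φ
  φ_θ : ∀ y, |y| ≤ 2 * T * L → φ (θ y) = y
  φ_injOn : InjOn φ (Icc (θ (-(2 * T * L))) (θ (2 * T * L)))
  bound : ∀ z, |f z| + ‖h‖ ≤ L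
  f_unif : ∀ ε > 0, ∃ δ > 0, ∀ t s s', |s' - s| ≤ δ → |f (t, s') - f (t, s)| ≤ ε
  f_zero : ∀ ε > 0, ∃ R, ∀ t s, R ≤ |s| → |f (t, s)| ≤ ε
  hasDerivAt_F : ∀ t s, HasDerivAt (fun s => F (t, s)) (f (t, s)) s
  F_lim : ∀ ε > 0, ∃ R, ∀ t s, R ≤ |s| → |F (t, s) - α| ≤ ε

namespace ResonantProblem

variable {T : ℝ} [hT : Fact (0 < T)] (D : ResonantProblem T)

/-- The bound `2TL` for `φ(u')`. -/
noncomputable def M : ℝ := 2 * T * D.L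

theorem M_nonneg : 0 ≤ D.M := by
  have := hT.out; have := D.L_pos; unfold M; positivity

theorem exists_shift (E : C(Icc (0 : ℝ) T, ℝ)) :
    ∃ c, |c| ≤ ‖E‖ ∧ total T (D.θ.comp (ContinuousMap.const _ c + E)) = 0 := by
  have hc : Continuous fun c : ℝ => total T (D.θ.comp (ContinuousMap.const _ c + E)) := by
    refine (total T).continuous.comp (ContinuousMap.continuous_of_continuous_uncurry _ ?_)
    simp only [Function.uncurry_def, ContinuousMap.comp_apply, ContinuousMap.add_apply,
      ContinuousMap.const_apply]
    fun_prop
  have hE : ∀ t, -‖E‖ ≤ E t ∧ E t ≤ ‖E‖ := fun t => abs_le.1 (E.norm_coe_le_norm t)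
  have h1 : total T (D.θ.comp (ContinuousMap.const _ (-‖E‖) + E)) ≤ 0 := by
    refine (total_mono (q := 0) fun t => ?_).trans_eq (map_zero _)
    exact (D.θ_strictMono.monotone (by linarith [hE t] : -‖E‖ + E t ≤ 0)).trans_eq D.θ_zero
  have h2 : 0 ≤ total T (D.θ.comp (ContinuousMap.const _ ‖E‖ + E)) := by
    refine total_nonneg fun t => ?_
    exact D.θ_zero.symm.trans_le
      (D.θ_strictMono.monotone (by linarith [hE t] : 0 ≤ ‖E‖ + E t))
  obtain ⟨c, hc1, hc2⟩ := intermediate_value_Icc (neg_le_self (norm_nonneg E)) hc.continuousOn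
    ⟨h1, h2⟩
  exact ⟨c, abs_le.2 hc1, hc2⟩

/-- The constant `c` for which `θ ∘ (c + E)` has integral zero. -/
noncomputable def shift (E : C(Icc (0 : ℝ) T, ℝ)) : ℝ := (D.exists_shift E).choose

theorem abs_shift_le (E : C(Icc (0 : ℝ) T, ℝ)) : |D.shift E| ≤ ‖E‖ :=
  (D.exists_shift E).choose_spec.1

/-- The slope `θ ∘ (c + E)` of integral zero, that is, the derivative of a periodic solution of
`(φ(u'))' = E'` up to the matching condition for `u'`. -/
noncomputable def slope (E : C(Icc (0 : ℝ) T, ℝ)) : C(Icc (0 : ℝ) T, ℝ) :=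
  D.θ.comp (ContinuousMap.const _ (D.shift E) + E)

theorem slope_apply (E : C(Icc (0 : ℝ) T, ℝ)) (t) : D.slope E t = D.θ (D.shift E + E t) := rfl

theorem total_slope (E : C(Icc (0 : ℝ) T, ℝ)) : total T (D.slope E) = 0 :=
  (D.exists_shift E).choose_spec.2

theorem shift_le (E E' : C(Icc (0 : ℝ) T, ℝ)) : D.shift E ≤ D.shift E' + ‖E - E'‖ := by
  by_contra! hlt
  have : total T (D.slope E') < total T (D.slope E) := by
    refine total_lt fun t => D.θ_strictMono ?_
    have := (abs_le.1 ((E - E').norm_coe_le_norm t)).1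
    simp only [ContinuousMap.add_apply, ContinuousMap.const_apply, ContinuousMap.sub_apply] at *
    linarith
  rw [D.total_slope, D.total_slope] at this
  exact lt_irrefl _ this

theorem continuous_shift : Continuous D.shift := by
  refine (LipschitzWith.of_dist_le_mul (K := 1) fun E E' => ?_).continuous
  rw [NNReal.coe_one, one_mul, Real.dist_eq, dist_eq_norm, abs_le]
  have h1 := D.shift_le E E'
  have h2 := D.shift_le E' E
  rw [norm_sub_rev] at h2
  constructor <;> linarith

theorem continuous_slope : Continuous D.slope := by
  have := D.continuous_shift
  refine ContinuousMap.continuous_of_continuous_uncurry _ ?_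
  simp only [Function.uncurry_def, slope_apply]
  fun_prop

/-! ### The convex part of the action functional -/

/-- The potential `∫₀ˣ φ`. -/
noncomputable def potential : C(ℝ, ℝ) where
  toFun x := ∫ s in (0 : ℝ)..x, D.φ s
  continuous_toFun := intervalIntegral.continuous_primitive
    (fun a b => D.φ.continuous.intervalIntegrable a b) 0

theorem hasDerivAt_potential (x : ℝ) : HasDerivAt D.potential (D.φ x) x :=
  (D.φ.continuous.integral_hasStrictDerivAt 0 x).hasDerivAt

/-- The graph of the potential lies above its tangents. -/
theorem tangent_le (x y : ℝ) : D.potential x + D.φ x * (y - x) ≤ D.potential y := by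
  have hi := fun a b => D.φ.continuous.intervalIntegrable (μ := volume) a b
  have hsub : D.potential y - D.potential x = ∫ s in x..y, D.φ s :=
    intervalIntegral.integral_interval_sub_left (hi _ _) (hi _ _)
  have : D.φ x * (y - x) ≤ ∫ s in x..y, D.φ s := by
    rcases le_total x y with hxy | hxy
    · have := intervalIntegral.integral_mono_on hxy (intervalIntegrable_const (μ := volume)
        (c := D.φ x)) (hi x y) fun s hs => D.φ_mono hs.1
      rw [intervalIntegral.integral_const, smul_eq_mul] at this
      linarith
    · have := intervalIntegral.integral_mono_on hxy (hi y x) (intervalIntegrable_const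
        (μ := volume) (c := D.φ x)) fun s hs => D.φ_mono hs.2
      rw [intervalIntegral.integral_const, smul_eq_mul] at this
      rw [intervalIntegral.integral_symm]
      linarith
  linarith

theorem potential_convex (x y : ℝ) {l : ℝ} (h0 : 0 ≤ l) (h1 : l ≤ 1) :
    D.potential (x + l * (y - x)) ≤ D.potential x + l * (D.potential y - D.potential x) := by
  have hx := D.tangent_le (x + l * (y - x)) x
  have hy := D.tangent_le (x + l * (y - x)) y
  have hx' := mul_le_mul_of_nonneg_left hx (sub_nonneg.2 h1)
  have hy' := mul_le_mul_of_nonneg_left hy h0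
  nlinarith

theorem φ_eq_of_tangent_eq {x y : ℝ} (h : D.potential y = D.potential x + D.φ x * (y - x)) :
    D.φ y = D.φ x := by
  -- `y` minimizes the difference between the potential and its tangent at `x`
  have hd : HasDerivAt (fun z => D.potential z - D.φ x * (z - x)) (D.φ y - D.φ x * 1) y :=
    (D.hasDerivAt_potential y).sub (((hasDerivAt_id y).sub_const x).const_mul _)
  have hmin : IsLocalMin (fun z => D.potential z - D.φ x * (z - x)) y :=
    Eventually.of_forall fun z => by
      have := D.tangent_le x z
      simp only
      linarith
  linarith [hmin.hasDerivAt_eq_zero hd]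

/-- The convex functional `p ↦ ∫ (Φ(p) - E p)`, with `Φ` the potential. -/
noncomputable def energy (E p : C(Icc (0 : ℝ) T, ℝ)) : ℝ :=
  total T (D.potential.comp p) - total T (E * p)

theorem continuous_energy :
    Continuous fun z : C(Icc (0 : ℝ) T, ℝ) × C(Icc (0 : ℝ) T, ℝ) => D.energy z.1 z.2 := by
  have : Continuous fun p : C(Icc (0 : ℝ) T, ℝ) => D.potential.comp p :=
    ContinuousMap.continuous_postcomp _
  unfold energy
  fun_prop

/-- The gap in the tangent inequality between `slope E` and `p`. -/
noncomputable def defect (E p : C(Icc (0 : ℝ) T, ℝ)) : C(Icc (0 : ℝ) T, ℝ) :=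
  D.potential.comp p - D.potential.comp (D.slope E) -
    (ContinuousMap.const _ (D.shift E) + E) * (p - D.slope E)

theorem energy_sub_eq (E : C(Icc (0 : ℝ) T, ℝ)) {p : C(Icc (0 : ℝ) T, ℝ)} (hp : total T p = 0) :
    D.energy E p - D.energy E (D.slope E) = total T (D.defect E p) := by
  have h := D.total_slope E
  rw [defect, add_mul]
  simp only [energy, map_sub, map_add, mul_sub, total_const_mul, hp, h]
  ring

theorem abs_shift_add_le {E : C(Icc (0 : ℝ) T, ℝ)} (hE : ‖E‖ ≤ T * D.L) (t) :
    |D.shift E + E t| ≤ 2 * T * D.L := by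
  have h1 := D.abs_shift_le E
  have h2 : |E t| ≤ ‖E‖ := E.norm_coe_le_norm t
  calc _ ≤ |D.shift E| + |E t| := abs_add_le _ _
    _ ≤ _ := by linarith

theorem φ_slope {E : C(Icc (0 : ℝ) T, ℝ)} (hE : ‖E‖ ≤ T * D.L) (t) :
    D.φ (D.slope E t) = D.shift E + E t :=
  D.φ_θ _ (D.abs_shift_add_le hE t)

theorem defect_apply {E : C(Icc (0 : ℝ) T, ℝ)} (hE : ‖E‖ ≤ T * D.L) (p) (t) :
    D.defect E p t = D.potential (p t) - D.potential (D.slope E t) -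
      D.φ (D.slope E t) * (p t - D.slope E t) := by
  rw [D.φ_slope hE]; rfl

theorem defect_nonneg {E : C(Icc (0 : ℝ) T, ℝ)} (hE : ‖E‖ ≤ T * D.L) (p) (t) :
    0 ≤ D.defect E p t := by
  rw [D.defect_apply hE]
  linarith [D.tangent_le (D.slope E t) (p t)]

/-- `slope E` minimizes the convex functional among functions of integral zero. -/
theorem energy_slope_le {E p : C(Icc (0 : ℝ) T, ℝ)} (hE : ‖E‖ ≤ T * D.L) (hp : total T p = 0) :
    D.energy E (D.slope E) ≤ D.energy E p := by
  have := D.energy_sub_eq E hp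
  linarith [total_nonneg (D.defect_nonneg hE p)]

theorem slope_mem_Icc {E : C(Icc (0 : ℝ) T, ℝ)} (hE : ‖E‖ ≤ T * D.L) (t) :
    D.slope E t ∈ Icc (D.θ (-D.M)) (D.θ D.M) := by
  have := abs_le.1 (D.abs_shift_add_le hE t)
  exact ⟨D.θ_strictMono.monotone this.1, D.θ_strictMono.monotone this.2⟩

/-- The minimizer of the convex functional is unique. -/
theorem eq_slope_of_energy_eq {E p : C(Icc (0 : ℝ) T, ℝ)} (hE : ‖E‖ ≤ T * D.L)
    (hp : total T p = 0) (hr : ∀ t, p t ∈ Icc (D.θ (-D.M)) (D.θ D.M))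
    (h : D.energy E p = D.energy E (D.slope E)) : p = D.slope E := by
  have h0 : D.defect E p = 0 := eq_zero_of_total_eq_zero (D.defect_nonneg hE p) (by
    rw [← D.energy_sub_eq E hp, h, sub_self])
  ext t
  have ht : D.defect E p t = 0 := by rw [h0]; rfl
  rw [D.defect_apply hE] at ht
  exact D.φ_injOn (hr t) (D.slope_mem_Icc hE t) (D.φ_eq_of_tangent_eq (by linarith))

end ResonantProblem

namespace ResonantProblem

/-! ### States, action and descent step -/

/-- The composition `t ↦ g(t, u(t))`. -/
def superpose {T : ℝ} (g : C(Icc (0 : ℝ) T × ℝ, ℝ)) (u : C(Icc (0 : ℝ) T, ℝ)) :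
    C(Icc (0 : ℝ) T, ℝ) :=
  g.comp ((ContinuousMap.id _).prodMk u)

theorem superpose_apply {T : ℝ} (g : C(Icc (0 : ℝ) T × ℝ, ℝ)) (u : C(Icc (0 : ℝ) T, ℝ)) (t) :
    superpose g u t = g (t, u t) := rfl

theorem continuous_superpose {T : ℝ} (g : C(Icc (0 : ℝ) T × ℝ, ℝ)) : Continuous (superpose g) := by
  refine ContinuousMap.continuous_of_continuous_uncurry _ ?_
  simp only [Function.uncurry_def, superpose_apply]
  fun_prop

variable {T : ℝ} [hT : Fact (0 < T)] (D : ResonantProblem T)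

/-- The function `u(t) = r + ∫₀ᵗ p` encoded by the state `(r, p)`. -/
noncomputable def trajectory (x : ℝ × C(Icc (0 : ℝ) T, ℝ)) : C(Icc (0 : ℝ) T, ℝ) :=
  ContinuousMap.const _ x.1 + prim T x.2

theorem trajectory_apply (x : ℝ × C(Icc (0 : ℝ) T, ℝ)) (t) :
    trajectory x t = x.1 + prim T x.2 t := rfl

theorem continuous_trajectory : Continuous (trajectory (T := T)) := by
  refine ContinuousMap.continuous_of_continuous_uncurry _ ?_
  simp only [Function.uncurry_def, trajectory_apply]
  fun_prop

/-- The primitive of the right-hand side `f(t, u) + h`. -/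
noncomputable def load (x : ℝ × C(Icc (0 : ℝ) T, ℝ)) : C(Icc (0 : ℝ) T, ℝ) :=
  prim T (superpose D.f (trajectory x) + D.h)

/-- The integral of `f(t, u)`. -/
noncomputable def drift (x : ℝ × C(Icc (0 : ℝ) T, ℝ)) : ℝ :=
  total T (superpose D.f (trajectory x))

/-- The action `∫ Φ(u') + F(t, u) + h u`, the last term being integrated by parts. -/
noncomputable def action (x : ℝ × C(Icc (0 : ℝ) T, ℝ)) : ℝ :=
  D.energy (prim T D.h) x.2 + total T (superpose D.F (trajectory x))

/-- The rate of decrease of the action along the descent step; its zeros are the critical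
points. -/
noncomputable def gap (x : ℝ × C(Icc (0 : ℝ) T, ℝ)) : ℝ :=
  D.energy (D.load x) x.2 - D.energy (D.load x) (D.slope (D.load x)) + D.drift x ^ 2

/-- The descent step of length `l`: the slope moves toward the minimizer of the convex part
linearized at `x`, and the initial value moves against the drift. -/
noncomputable def step (l : ℝ) (x : ℝ × C(Icc (0 : ℝ) T, ℝ)) : ℝ × C(Icc (0 : ℝ) T, ℝ) :=
  (x.1 - l * D.drift x, x.2 + l • (D.slope (D.load x) - x.2))

theorem continuous_load : Continuous D.load := by
  have h1 := continuous_superpose D.f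
  have h2 := continuous_trajectory (T := T)
  unfold load
  fun_prop

theorem continuous_drift : Continuous D.drift := by
  have h1 := continuous_superpose D.f
  have h2 := continuous_trajectory (T := T)
  unfold drift
  fun_prop

theorem continuous_gap : Continuous D.gap := by
  have h1 := D.continuous_load
  have h2 := D.continuous_drift
  have h3 := D.continuous_slope
  have h4 := D.continuous_energy.comp (h1.prodMk continuous_snd)
  have h5 := D.continuous_energy.comp (h1.prodMk (h3.comp h1))
  exact (h4.sub h5).add (h2.pow 2)

theorem continuous_step (l : ℝ) : Continuous (D.step l) := by
  have h1 := D.continuous_load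
  have h2 := D.continuous_drift
  have h3 := D.continuous_slope
  unfold step
  fun_prop

theorem norm_rhs_le (u : C(Icc (0 : ℝ) T, ℝ)) : ‖superpose D.f u + D.h‖ ≤ D.L :=
  (ContinuousMap.norm_le _ D.L_pos.le).2 fun t => by
    have h1 := D.bound (t, u t)
    have h2 : |D.h t| ≤ ‖D.h‖ := D.h.norm_coe_le_norm t
    exact (abs_add_le _ _).trans (by rw [superpose_apply]; linarith)

theorem norm_superpose_le (u : C(Icc (0 : ℝ) T, ℝ)) : ‖superpose D.f u‖ ≤ D.L :=
  (ContinuousMap.norm_le _ D.L_pos.le).2 fun t => by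
    have h1 := D.bound (t, u t)
    rw [Real.norm_eq_abs, superpose_apply]
    linarith [norm_nonneg D.h]

theorem norm_load_le (x) : ‖D.load x‖ ≤ T * D.L :=
  (norm_prim_le _).trans (mul_le_mul_of_nonneg_left (D.norm_rhs_le _) hT.out.le)

theorem norm_prim_h_le : ‖prim T D.h‖ ≤ T * D.L := by
  refine (norm_prim_le _).trans (mul_le_mul_of_nonneg_left ?_ hT.out.le)
  have := D.bound (⟨0, left_mem_Icc.2 hT.out.le⟩, 0)
  linarith [abs_nonneg (D.f (⟨0, left_mem_Icc.2 hT.out.le⟩, 0))]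

theorem abs_drift_le (x) : |D.drift x| ≤ T * D.L :=
  (abs_total_le _).trans (mul_le_mul_of_nonneg_left (D.norm_superpose_le _) hT.out.le)

/-! ### The compact convex set of admissible slopes -/

/-- The admissible slopes: integral zero, values in `[θ(-M), θ(M)]`, and the modulus of continuity
of the functions `θ ∘ q` with `q` Lipschitz of constant `L` and values in `[-M, M]`. The last
property says that each pair `(ε, δ)` admissible for the uniform continuity of `θ` on `[-M, M]` serves
for `p` too, after rescaling time by `L`. -/
def slopes : Set C(Icc (0 : ℝ) T, ℝ) :=
  {p | total T p = 0 ∧ (∀ t, p t ∈ Icc (D.θ (-D.M)) (D.θ D.M)) ∧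
    ∀ ε > 0, ∀ δ > 0, (∀ x ∈ Icc (-D.M) D.M, ∀ y ∈ Icc (-D.M) D.M, |x - y| ≤ δ →
      |D.θ x - D.θ y| ≤ ε) → ∀ s t : Icc (0 : ℝ) T, D.L * |(s : ℝ) - t| ≤ δ → |p s - p t| ≤ ε}

theorem zero_mem_slopes : (0 : C(Icc (0 : ℝ) T, ℝ)) ∈ D.slopes := by
  have hM := D.M_nonneg
  refine ⟨map_zero _, fun t => ⟨?_, ?_⟩, fun ε hε δ hδ _ s t _ => by simpa using hε.le⟩
  · exact (D.θ_strictMono.monotone (neg_nonpos.2 hM)).trans_eq D.θ_zero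
  · exact D.θ_zero.symm.trans_le (D.θ_strictMono.monotone hM)

theorem slope_load_mem (x) : D.slope (D.load x) ∈ D.slopes := by
  have hb : ∀ t, D.shift (D.load x) + D.load x t ∈ Icc (-D.M) D.M := fun t =>
    abs_le.1 (D.abs_shift_add_le (D.norm_load_le x) t)
  refine ⟨D.total_slope _, D.slope_mem_Icc (D.norm_load_le x), fun ε _ δ _ hθ s t hst => ?_⟩
  refine hθ _ (hb s) _ (hb t) (le_trans ?_ hst)
  have h := abs_prim_sub_le (superpose D.f (trajectory x) + D.h) s t
  have h' := mul_le_mul_of_nonneg_right (D.norm_rhs_le (trajectory x)) (abs_nonneg ((s : ℝ) - t))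
  simp only [ContinuousMap.add_apply, ContinuousMap.const_apply, add_sub_add_left_eq_sub]
  exact h.trans h'

theorem convex_slopes {p q : C(Icc (0 : ℝ) T, ℝ)} (hp : p ∈ D.slopes) (hq : q ∈ D.slopes) {l : ℝ}
    (h0 : 0 ≤ l) (h1 : l ≤ 1) : p + l • (q - p) ∈ D.slopes := by
  obtain ⟨hp1, hp2, hp3⟩ := hp
  obtain ⟨hq1, hq2, hq3⟩ := hq
  refine ⟨by simp [hp1, hq1], fun t => ?_, fun ε hε δ hδ hθ s t hst => ?_⟩
  · have h := (convex_Icc (D.θ (-D.M)) (D.θ D.M)) (hp2 t) (hq2 t) (sub_nonneg.2 h1) h0 (by ring)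
    convert h using 1
    simp only [ContinuousMap.add_apply, ContinuousMap.smul_apply, ContinuousMap.sub_apply,
      smul_eq_mul]
    ring
  · have hp' := hp3 ε hε δ hδ hθ s t hst
    have hq' := hq3 ε hε δ hδ hθ s t hst
    have he : (p + l • (q - p)) s - (p + l • (q - p)) t
        = (1 - l) * (p s - p t) + l * (q s - q t) := by
      simp only [ContinuousMap.add_apply, ContinuousMap.smul_apply, ContinuousMap.sub_apply,
        smul_eq_mul]
      ring
    rw [he]
    refine (abs_add_le _ _).trans ?_
    rw [abs_mul, abs_mul, abs_of_nonneg h0, abs_of_nonneg (sub_nonneg.2 h1)]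
    nlinarith [mul_le_mul_of_nonneg_left hp' (sub_nonneg.2 h1), mul_le_mul_of_nonneg_left hq' h0]

theorem isClosed_slopes : IsClosed D.slopes := by
  have hev : ∀ t : Icc (0 : ℝ) T, Continuous fun p : C(Icc (0 : ℝ) T, ℝ) => p t := fun t => by
    fun_prop
  simp only [slopes, ofPred_and, ofPred_forall]
  refine (isClosed_eq (total T).continuous continuous_const).inter (IsClosed.inter ?_ ?_)
  · exact isClosed_iInter fun t => isClosed_Icc.preimage (hev t)
  · refine isClosed_iInter fun ε => isClosed_iInter fun _ => isClosed_iInter fun δ =>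
      isClosed_iInter fun _ => isClosed_iInter fun _ => isClosed_iInter fun s =>
      isClosed_iInter fun t => isClosed_iInter fun _ => ?_
    exact isClosed_le ((hev s).sub (hev t)).abs continuous_const

theorem isCompact_slopes : IsCompact D.slopes := by
  let e := (ContinuousMap.isometryEquivBoundedOfCompact (Icc (0 : ℝ) T) ℝ).toHomeomorph
  have key : IsCompact (e.symm ⁻¹' D.slopes) := by
    refine BoundedContinuousFunction.arzela_ascoli₂ (Icc (D.θ (-D.M)) (D.θ D.M)) isCompact_Icc _
      (D.isClosed_slopes.preimage e.symm.continuous) (fun p t hp => hp.2.1 t) ?_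
    intro t₀
    rw [Metric.equicontinuousAt_iff]
    intro ε hε
    have hu := (isCompact_Icc (a := -D.M) (b := D.M)).uniformContinuousOn_of_continuous
      D.θ.continuous.continuousOn
    obtain ⟨δ, hδ, hθ⟩ := Metric.uniformContinuousOn_iff.1 hu (ε / 2) (half_pos hε)
    refine ⟨δ / 2 / D.L, div_pos (half_pos hδ) D.L_pos, fun t ht p => ?_⟩
    have h := p.2.2.2 (ε / 2) (half_pos hε) (δ / 2) (half_pos hδ)
      (fun x hx y hy hxy => (hθ x hx y hy (lt_of_le_of_lt hxy (half_lt_self hδ))).le) t₀ t (by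
        rw [Subtype.dist_eq, Real.dist_eq, lt_div_iff₀ D.L_pos, abs_sub_comm] at ht
        linarith)
    exact lt_of_le_of_lt h (half_lt_self hε)
  have := key.image e.symm.continuous
  rwa [image_preimage_eq _ e.symm.surjective] at this

/-- A bound for the admissible slopes. -/
noncomputable def K : ℝ := max |D.θ (-D.M)| |D.θ D.M|

theorem K_nonneg : 0 ≤ D.K := (abs_nonneg _).trans (le_max_left _ _)

theorem norm_le_of_mem_slopes {p : C(Icc (0 : ℝ) T, ℝ)} (hp : p ∈ D.slopes) : ‖p‖ ≤ D.K :=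
  (ContinuousMap.norm_le _ D.K_nonneg).2 fun t => abs_le_max_abs_abs (hp.2.1 t).1 (hp.2.1 t).2

theorem step_mem {l : ℝ} (h0 : 0 ≤ l) (h1 : l ≤ 1) {x : ℝ × C(Icc (0 : ℝ) T, ℝ)}
    (hx : x.2 ∈ D.slopes) : (D.step l x).2 ∈ D.slopes :=
  D.convex_slopes hx (D.slope_load_mem x) h0 h1

theorem gap_nonneg {x : ℝ × C(Icc (0 : ℝ) T, ℝ)} (hx : x.2 ∈ D.slopes) : 0 ≤ D.gap x := by
  have := D.energy_slope_le (D.norm_load_le x) hx.1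
  have := sq_nonneg (D.drift x)
  unfold gap
  linarith

/-! ### Decrease of the action along a descent step -/

/-- First order expansion of `F` with a remainder controlled uniformly. -/
theorem F_expand {ε δ : ℝ} (hf : ∀ t s s', |s' - s| ≤ δ → |D.f (t, s') - D.f (t, s)| ≤ ε)
    (t : Icc (0 : ℝ) T) (s v : ℝ) (hv : |v| ≤ δ) :
    |D.F (t, s + v) - D.F (t, s) - D.f (t, s) * v| ≤ ε * |v| := by
  have hd : ∀ z ∈ uIcc s (s + v), HasDerivWithinAt (fun z => D.F (t, z) - D.f (t, s) * z)
      (D.f (t, z) - D.f (t, s) * 1) (uIcc s (s + v)) z := fun z _ =>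
    ((D.hasDerivAt_F t z).sub ((hasDerivAt_id z).const_mul _)).hasDerivWithinAt
  have hb : ∀ z ∈ uIcc s (s + v), ‖D.f (t, z) - D.f (t, s) * 1‖ ≤ ε := fun z hz => by
    rw [mul_one]
    refine hf t s z (le_trans ?_ hv)
    simpa using abs_sub_left_of_mem_uIcc hz
  have h := (convex_uIcc s (s + v)).norm_image_sub_le_of_norm_hasDerivWithin_le hd hb
    left_mem_uIcc right_mem_uIcc
  rw [Real.norm_eq_abs, Real.norm_eq_abs, add_sub_cancel_left] at h
  convert h using 2
  ring

theorem energy_step_le (E p q : C(Icc (0 : ℝ) T, ℝ)) {l : ℝ} (h0 : 0 ≤ l) (h1 : l ≤ 1) :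
    D.energy E (p + l • (q - p)) ≤ D.energy E p + l * (D.energy E q - D.energy E p) := by
  have h : total T (D.potential.comp (p + l • (q - p))) ≤
      total T (D.potential.comp p + l • (D.potential.comp q - D.potential.comp p)) :=
    total_mono fun t => D.potential_convex (p t) (q t) h0 h1
  simp only [map_add, map_sub, map_smul, smul_eq_mul] at h
  simp only [energy, mul_add, mul_sub, mul_smul_comm, map_add, map_sub, map_smul, smul_eq_mul]
  linarith

/-- The direction of the descent step, in terms of trajectories. -/
noncomputable def direction (x : ℝ × C(Icc (0 : ℝ) T, ℝ)) : C(Icc (0 : ℝ) T, ℝ) :=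
  ContinuousMap.const _ (-D.drift x) + prim T (D.slope (D.load x) - x.2)

theorem trajectory_step (l : ℝ) (x : ℝ × C(Icc (0 : ℝ) T, ℝ)) :
    trajectory (D.step l x) = trajectory x + l • D.direction x := by
  ext t
  simp only [trajectory, step, direction, map_add, map_smul, ContinuousMap.add_apply,
    ContinuousMap.const_apply, ContinuousMap.smul_apply, smul_eq_mul]
  ring

theorem total_mul_direction {x : ℝ × C(Icc (0 : ℝ) T, ℝ)} (hx : x.2 ∈ D.slopes) :
    total T (superpose D.f (trajectory x) * D.direction x) = -D.drift x ^ 2 -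
      total T (prim T (superpose D.f (trajectory x)) * (D.slope (D.load x) - x.2)) := by
  have h0 : total T (D.slope (D.load x) - x.2) = 0 := by
    rw [map_sub, D.total_slope, hx.1, sub_zero]
  rw [direction, mul_add, map_add, total_mul_prim _ h0, mul_comm, total_const_mul]
  change -D.drift x * D.drift x + _ = _
  ring

theorem norm_direction_le {x : ℝ × C(Icc (0 : ℝ) T, ℝ)} (hx : x.2 ∈ D.slopes) :
    ‖D.direction x‖ ≤ T * D.L + T * (2 * D.K) := by
  have hp := D.norm_le_of_mem_slopes hx
  have hq := D.norm_le_of_mem_slopes (D.slope_load_mem x)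
  have h1 : ‖prim T (D.slope (D.load x) - x.2)‖ ≤ T * (2 * D.K) :=
    (norm_prim_le _).trans
      (mul_le_mul_of_nonneg_left ((norm_sub_le _ _).trans (by linarith)) hT.out.le)
  refine (norm_add_le _ _).trans (add_le_add ?_ h1)
  refine (ContinuousMap.norm_le _ ((abs_nonneg _).trans (D.abs_drift_le x))).2 fun t => ?_
  simpa using D.abs_drift_le x

/-- The descent step of length `l` lowers the action by `l * gap`, up to an error which is `o(l)`
uniformly. -/
theorem action_step_le {ε : ℝ} (hε : 0 < ε) :
    ∃ l > 0, l ≤ 1 ∧ ∀ x : ℝ × C(Icc (0 : ℝ) T, ℝ), x.2 ∈ D.slopes →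
      D.action (D.step l x) ≤ D.action x - l * D.gap x + l * ε := by
  have hTp := hT.out
  have hL := D.L_pos
  have hK := D.K_nonneg
  obtain ⟨W, hW, hdir⟩ : ∃ W > 0, ∀ x : ℝ × C(Icc (0 : ℝ) T, ℝ), x.2 ∈ D.slopes →
      ‖D.direction x‖ ≤ W := ⟨T * D.L + T * (2 * D.K), by positivity,
    fun x hx => D.norm_direction_le hx⟩
  obtain ⟨δ, hδ, hf⟩ := D.f_unif (ε / (T * W)) (by positivity)
  refine ⟨min 1 (δ / W), lt_min one_pos (by positivity), min_le_left _ _, fun x hx => ?_⟩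
  set l := min 1 (δ / W) with hl
  have hl0 : 0 < l := lt_min one_pos (by positivity)
  have hl1 : l ≤ 1 := min_le_left _ _
  have hlW : l * W ≤ δ := by
    have := mul_le_mul_of_nonneg_right (min_le_right 1 (δ / W)) hW.le
    rwa [div_mul_cancel₀ _ hW.ne'] at this
  have hd : ∀ t, |l * D.direction x t| ≤ l * W := fun t => by
    rw [abs_mul, abs_of_pos hl0]
    exact mul_le_mul_of_nonneg_left (((D.direction x).norm_coe_le_norm t).trans (hdir x hx)) hl0.le
  have hF : total T (superpose D.F (trajectory (D.step l x))) ≤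
      total T (superpose D.F (trajectory x) +
        (l • (superpose D.f (trajectory x) * D.direction x) +
          ContinuousMap.const _ (ε / (T * W) * (l * W)))) := by
    refine total_mono fun t => ?_
    rw [trajectory_step]
    simp only [superpose_apply, ContinuousMap.add_apply, ContinuousMap.smul_apply,
      ContinuousMap.mul_apply, ContinuousMap.const_apply, smul_eq_mul]
    have h1 := le_of_abs_le (D.F_expand hf t (trajectory x t) _ ((hd t).trans hlW))
    have h2 := mul_le_mul_of_nonneg_left (hd t) (by positivity : 0 ≤ ε / (T * W))
    linarith
  have he : T * (ε / (T * W) * (l * W)) = l * ε := by field_simp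
  rw [map_add, map_add, map_smul, smul_eq_mul, total_const, he, D.total_mul_direction hx] at hF
  have hE := D.energy_step_le (prim T D.h) x.2 (D.slope (D.load x)) hl0.le hl1
  have hg : D.gap x = D.energy (prim T D.h) x.2 - D.energy (prim T D.h) (D.slope (D.load x)) +
      total T (prim T (superpose D.f (trajectory x)) * (D.slope (D.load x) - x.2)) +
      D.drift x ^ 2 := by
    rw [gap]
    conv_lhs => simp only [energy, load, map_add, add_mul]
    simp only [energy, mul_sub, map_sub, load, map_add]
    ring
  rw [hg, action, action]
  change D.energy _ (x.2 + l • (D.slope (D.load x) - x.2)) + _ ≤ _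
  nlinarith

/-! ### Compactness away from the level at infinity -/

theorem exists_gap_ge (hne : ∀ x : ℝ × C(Icc (0 : ℝ) T, ℝ), x.2 ∈ D.slopes → D.gap x ≠ 0)
    {R : ℝ} (hR : 0 ≤ R) : ∃ δ > 0, ∀ x : ℝ × C(Icc (0 : ℝ) T, ℝ), x.2 ∈ D.slopes →
      |x.1| ≤ R → δ ≤ D.gap x := by
  obtain ⟨y, hy, hmin⟩ := ((isCompact_Icc (a := -R) (b := R)).prod
    D.isCompact_slopes).exists_isMinOn ⟨(0, 0), ⟨by simpa using hR, D.zero_mem_slopes⟩⟩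
    D.continuous_gap.continuousOn
  exact ⟨D.gap y, lt_of_le_of_ne (D.gap_nonneg hy.2) (hne y hy.2).symm, fun x hx hxR =>
    hmin ⟨abs_le.1 hxR, hx⟩⟩

theorem exists_pos_mul_le_of_pos {A m : ℝ} (hA : 0 < A) (hm : 0 < m) :
    ∃ η > 0, η ≤ 1 ∧ A * η ≤ m := by
  refine ⟨min 1 (m / A), lt_min one_pos (div_pos hm hA), min_le_left _ _, ?_⟩
  rw [mul_comm]
  exact (le_div_iff₀ hA).1 (min_le_right _ _)

/-- The level of the action approached by critical sequences escaping to infinity. -/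
noncomputable def levelAtInfinity : ℝ :=
  T * D.α + D.energy (prim T D.h) (D.slope (prim T D.h))

theorem abs_trajectory_ge {x : ℝ × C(Icc (0 : ℝ) T, ℝ)} (hx : x.2 ∈ D.slopes) (t) :
    |x.1| - T * D.K ≤ |trajectory x t| := by
  have h1 : |prim T x.2 t| ≤ T * D.K := ((prim T x.2).norm_coe_le_norm t).trans
    ((norm_prim_le _).trans (mul_le_mul_of_nonneg_left (D.norm_le_of_mem_slopes hx) hT.out.le))
  have h2 := abs_sub_abs_le_abs_sub x.1 (-prim T x.2 t)
  rw [abs_neg, sub_neg_eq_add] at h2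
  rw [trajectory_apply]
  linarith

theorem total_mul_le (p q : C(Icc (0 : ℝ) T, ℝ)) : |total T (p * q)| ≤ T * (‖p‖ * ‖q‖) :=
  (abs_total_le _).trans (mul_le_mul_of_nonneg_left (norm_mul_le _ _) hT.out.le)

theorem continuous_energy_slope :
    Continuous fun E : C(Icc (0 : ℝ) T, ℝ) => D.energy E (D.slope E) := by
  have h := D.continuous_energy.comp (continuous_id.prodMk D.continuous_slope)
  exact h

/-- Far away the action differs from the gap by the level at infinity only. -/
theorem exists_far {ε : ℝ} (hε : 0 < ε) :
    ∃ R, 0 ≤ R ∧ ∀ x : ℝ × C(Icc (0 : ℝ) T, ℝ), x.2 ∈ D.slopes → R ≤ |x.1| →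
      |D.action x - D.gap x - D.levelAtInfinity| ≤ ε := by
  have hTp := hT.out
  have hK := D.K_nonneg
  have hm := D.continuous_energy_slope
  obtain ⟨δ, hδ, hm⟩ := Metric.continuous_iff.1 hm (prim T D.h) (ε / 4) (by positivity)
  have hA : 0 < 1 + T + T * T + T * (T * D.K) := by positivity
  obtain ⟨η, hη, hη1, hηA⟩ := exists_pos_mul_le_of_pos hA
    (lt_min (by positivity : 0 < ε / 4) (by positivity : 0 < δ / 2))
  have hηε := hηA.trans (min_le_left _ _)
  have hηδ := hηA.trans (min_le_right _ _)
  have hn1 : 0 ≤ T * η := by positivity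
  have hn2 : 0 ≤ T * T * η := by positivity
  have hn3 : 0 ≤ T * (T * D.K) * η := by positivity
  obtain ⟨R₁, hR₁⟩ := D.f_zero η hη
  obtain ⟨R₂, hR₂⟩ := D.F_lim η hη
  obtain ⟨R, hR0, hR⟩ : ∃ R, 0 ≤ R ∧ max R₁ R₂ + T * D.K ≤ R :=
    ⟨max 0 (max R₁ R₂ + T * D.K), le_max_left _ _, le_max_right _ _⟩
  refine ⟨R, hR0, ?_⟩
  intro x hx hxR
  have hfar : ∀ t, max R₁ R₂ ≤ |trajectory x t| := fun t => by
    have := D.abs_trajectory_ge hx t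
    linarith
  have hf : ‖superpose D.f (trajectory x)‖ ≤ η := (ContinuousMap.norm_le _ hη.le).2 fun t =>
    hR₁ t _ ((le_max_left _ _).trans (hfar t))
  have hF : ‖superpose D.F (trajectory x) - ContinuousMap.const _ D.α‖ ≤ η :=
    (ContinuousMap.norm_le _ hη.le).2 fun t => hR₂ t _ ((le_max_right _ _).trans (hfar t))
  have hF' : |total T (superpose D.F (trajectory x)) - T * D.α| ≤ T * η := by
    rw [← total_const, ← map_sub]
    exact (abs_total_le _).trans (mul_le_mul_of_nonneg_left hF hTp.le)
  have hprim : ‖prim T (superpose D.f (trajectory x))‖ ≤ T * η :=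
    (norm_prim_le _).trans (mul_le_mul_of_nonneg_left hf hTp.le)
  have hG : D.drift x ^ 2 ≤ T * T * η := by
    have h1 : |D.drift x| ≤ T * η := (abs_total_le _).trans (mul_le_mul_of_nonneg_left hf hTp.le)
    rw [← sq_abs]
    calc |D.drift x| ^ 2 ≤ (T * η) ^ 2 := by gcongr
      _ = T * T * η * η := by ring
      _ ≤ T * T * η * 1 := by gcongr
      _ = _ := mul_one _
  have hload : D.load x - prim T D.h = prim T (superpose D.f (trajectory x)) := by
    rw [load, map_add, add_sub_cancel_right]
  have hmin := hm (D.load x) (by rw [dist_eq_norm, hload]; linarith)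
  rw [Real.dist_eq] at hmin
  have hlin : |total T (prim T (superpose D.f (trajectory x)) * x.2)| ≤ T * (T * D.K) * η := by
    calc _ ≤ T * (‖prim T (superpose D.f (trajectory x))‖ * ‖x.2‖) := total_mul_le _ _
      _ ≤ T * ((T * η) * D.K) := by
          have := D.norm_le_of_mem_slopes hx
          gcongr
      _ = _ := by ring
  have hdiff : D.energy (prim T D.h) x.2 - D.energy (D.load x) x.2 =
      total T (prim T (superpose D.f (trajectory x)) * x.2) := by
    rw [← hload, sub_mul, map_sub, energy, energy]
    ring
  have he : D.action x - D.gap x - D.levelAtInfinity =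
      (total T (superpose D.F (trajectory x)) - T * D.α) +
      total T (prim T (superpose D.f (trajectory x)) * x.2) +
      (D.energy (D.load x) (D.slope (D.load x)) -
        D.energy (prim T D.h) (D.slope (prim T D.h))) - D.drift x ^ 2 := by
    rw [← hdiff, action, gap, levelAtInfinity]
    ring
  have h0 := sq_nonneg (D.drift x)
  rw [he]
  rw [abs_le] at hF' hlin ⊢
  have hmin' := abs_lt.1 hmin
  constructor <;> linarith

/-! ### The minimax principle -/

/-- The minimax level of a family of sets invariant under the descent steps is critical, unless
it is the level at infinity. -/
theorem exists_gap_eq_zero_of_minimax (𝒢 : Set (Set (ℝ × C(Icc (0 : ℝ) T, ℝ))))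
    (hsub : ∀ A ∈ 𝒢, ∀ x ∈ A, x.2 ∈ D.slopes)
    (hstep : ∀ A ∈ 𝒢, ∀ l, 0 ≤ l → l ≤ 1 → D.step l '' A ∈ 𝒢)
    (hbdd : BddBelow {m | ∃ A ∈ 𝒢, ∀ x ∈ A, D.action x ≤ m})
    (hne : {m | ∃ A ∈ 𝒢, ∀ x ∈ A, D.action x ≤ m}.Nonempty)
    (hc : sInf {m | ∃ A ∈ 𝒢, ∀ x ∈ A, D.action x ≤ m} ≠ D.levelAtInfinity) :
    ∃ x : ℝ × C(Icc (0 : ℝ) T, ℝ), x.2 ∈ D.slopes ∧ D.gap x = 0 := by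
  by_contra! hno
  set c := sInf {m | ∃ A ∈ 𝒢, ∀ x ∈ A, D.action x ≤ m} with hcdef
  set ε := |c - D.levelAtInfinity| / 3 with hεdef
  have hε : 0 < ε := by have := abs_pos.2 (sub_ne_zero.2 hc); positivity
  obtain ⟨R, hR, hfar⟩ := D.exists_far hε
  obtain ⟨δ₁, hδ₁, hnear⟩ := D.exists_gap_ge hno hR
  set δ := min δ₁ ε
  have hδ : 0 < δ := lt_min hδ₁ hε
  have hδε : δ ≤ ε := min_le_right _ _
  -- near the level `c` the gap is bounded below, also far away as `c` is not the level there
  have hgap : ∀ x : ℝ × C(Icc (0 : ℝ) T, ℝ), x.2 ∈ D.slopes → |D.action x - c| ≤ ε →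
      δ ≤ D.gap x := fun x hx hxc => by
    rcases le_total |x.1| R with h | h
    · exact (min_le_left _ _).trans (hnear x hx h)
    · refine hδε.trans ?_
      have h1 := hfar x hx h
      have h2 := D.gap_nonneg hx
      have h3 : |c - D.levelAtInfinity| = 3 * ε := by rw [hεdef]; ring
      rw [abs_le] at h1 hxc
      rcases abs_cases (c - D.levelAtInfinity) with h4 | h4 <;> linarith
  obtain ⟨l, hl, hl1, hdesc⟩ := D.action_step_le (half_pos hδ)
  have hlδ : 0 < l * δ := by positivity
  have hlδε : l * δ ≤ ε := (mul_le_mul hl1 hδε hδ.le zero_le_one).trans_eq (one_mul _)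
  obtain ⟨m, ⟨A, hA, hAm⟩, hm⟩ := exists_lt_of_csInf_lt hne
    (show c < c + l * δ / 4 by linarith)
  have hnew : c - l * δ / 4 ∈ {m | ∃ A ∈ 𝒢, ∀ x ∈ A, D.action x ≤ m} := by
    refine ⟨_, hstep A hA l hl.le hl1, ?_⟩
    rintro _ ⟨x, hxA, rfl⟩
    have hx := hsub A hA x hxA
    have h1 := hdesc x hx
    have h2 := hAm x hxA
    rcases le_total (c - ε) (D.action x) with h | h
    · have h3 := mul_le_mul_of_nonneg_left
        (hgap x hx (abs_le.2 ⟨by linarith, by linarith⟩)) hl.le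
      linarith
    · have h3 := mul_nonneg hl.le (D.gap_nonneg hx)
      linarith
  linarith [csInf_le hbdd hnew]

end ResonantProblem

/-! ### Existence of a critical state -/

theorem exists_bound_of_bound_far {X : Type*} [TopologicalSpace X] [CompactSpace X]
    {g : C(X × ℝ, ℝ)} {c : ℝ} (h : ∃ R, ∀ t s, R ≤ |s| → |g (t, s) - c| ≤ 1) :
    ∃ B, ∀ z, |g z| ≤ B := by
  obtain ⟨R, hR⟩ := h
  obtain ⟨B, hB⟩ := (isCompact_univ.prod
    (isCompact_Icc (a := -R) (b := R))).exists_bound_of_continuousOn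
    (f := g) g.continuous.continuousOn
  refine ⟨max B (|c| + 1), fun ⟨t, s⟩ => ?_⟩
  rcases le_total |s| R with h | h
  · exact (hB (t, s) ⟨mem_univ _, abs_le.1 h⟩).trans (le_max_left _ _)
  · have h1 := hR t s h
    have h2 := abs_sub_abs_le_abs_sub (g (t, s)) c
    exact le_trans (by linarith) (le_max_right _ _)

namespace ResonantProblem

variable {T : ℝ} [hT : Fact (0 < T)] (D : ResonantProblem T)

theorem exists_bound_F : ∃ B, ∀ z, |D.F z| ≤ B :=
  exists_bound_of_bound_far ((D.F_lim 1 one_pos).imp fun _ h t s => h t s)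

theorem abs_total_F_le {B : ℝ} (hB : ∀ z, |D.F z| ≤ B) (u : C(Icc (0 : ℝ) T, ℝ)) :
    |total T (superpose D.F u)| ≤ T * B := by
  refine (abs_total_le _).trans (mul_le_mul_of_nonneg_left ?_ hT.out.le)
  have h0 : 0 ≤ B := (abs_nonneg _).trans (hB (⟨0, left_mem_Icc.2 hT.out.le⟩, 0))
  exact (ContinuousMap.norm_le _ h0).2 fun t => hB _

theorem exists_le_action : ∃ m, ∀ x : ℝ × C(Icc (0 : ℝ) T, ℝ), x.2 ∈ D.slopes →
    m ≤ D.action x := by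
  obtain ⟨B, hB⟩ := D.exists_bound_F
  refine ⟨D.energy (prim T D.h) (D.slope (prim T D.h)) - T * B, fun x hx => ?_⟩
  have h1 := D.energy_slope_le D.norm_prim_h_le hx.1
  have h2 := (abs_le.1 (D.abs_total_F_le hB (trajectory x))).1
  unfold action
  linarith

/-- The ranges of the paths of admissible states whose initial value goes from `-∞` to `∞`. -/
def crossingPaths : Set (Set (ℝ × C(Icc (0 : ℝ) T, ℝ))) :=
  {A | ∃ γ : ℝ → ℝ × C(Icc (0 : ℝ) T, ℝ), Continuous γ ∧ (∀ s, (γ s).2 ∈ D.slopes) ∧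
    Tendsto (fun s => (γ s).1) atTop atTop ∧ Tendsto (fun s => (γ s).1) atBot atBot ∧
    A = range γ}

theorem step_image_mem_crossingPaths {A : Set (ℝ × C(Icc (0 : ℝ) T, ℝ))}
    (hA : A ∈ D.crossingPaths) {l : ℝ} (h0 : 0 ≤ l) (h1 : l ≤ 1) :
    D.step l '' A ∈ D.crossingPaths := by
  obtain ⟨γ, hγ, hs, htop, hbot, rfl⟩ := hA
  have hd : ∀ x, |l * D.drift x| ≤ T * D.L := fun x => by
    rw [abs_mul, abs_of_nonneg h0]
    exact (mul_le_of_le_one_left (abs_nonneg _) h1).trans (D.abs_drift_le x)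
  refine ⟨D.step l ∘ γ, (D.continuous_step l).comp hγ, fun s => D.step_mem h0 h1 (hs s), ?_, ?_,
    (range_comp _ _).symm⟩
  · refine tendsto_atTop_mono (fun s => ?_) (tendsto_atTop_add_const_right _ (-(T * D.L)) htop)
    have := (abs_le.1 (hd (γ s))).2
    change _ ≤ (γ s).1 - l * D.drift (γ s)
    linarith
  · refine tendsto_atBot_mono (fun s => ?_) (tendsto_atBot_add_const_right _ (T * D.L) hbot)
    have := (abs_le.1 (hd (γ s))).1
    change (γ s).1 - l * D.drift (γ s) ≤ _
    linarith

/-- The problem always has a critical state. -/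
theorem exists_gap_eq_zero : ∃ x : ℝ × C(Icc (0 : ℝ) T, ℝ), x.2 ∈ D.slopes ∧ D.gap x = 0 := by
  by_contra hno
  obtain ⟨m, hm⟩ := D.exists_le_action
  -- the infimum of the action is the level at infinity
  have hbdd₁ : BddBelow {r | ∃ A ∈ {A : Set (ℝ × C(Icc (0 : ℝ) T, ℝ)) |
      ∃ x, x.2 ∈ D.slopes ∧ A = {x}}, ∀ x ∈ A, D.action x ≤ r} := by
    refine ⟨m, ?_⟩
    rintro r ⟨_, ⟨x, hx, rfl⟩, hr⟩
    exact (hm x hx).trans (hr x rfl)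
  have hinf : sInf {r | ∃ A ∈ {A : Set (ℝ × C(Icc (0 : ℝ) T, ℝ)) |
      ∃ x, x.2 ∈ D.slopes ∧ A = {x}}, ∀ x ∈ A, D.action x ≤ r} = D.levelAtInfinity := by
    by_contra hc
    refine hno (D.exists_gap_eq_zero_of_minimax _ ?_ ?_ hbdd₁ ?_ hc)
    · rintro _ ⟨x, hx, rfl⟩ _ rfl
      exact hx
    · rintro _ ⟨x, hx, rfl⟩ l h0 h1
      exact ⟨D.step l x, D.step_mem h0 h1 hx, image_singleton⟩
    · exact ⟨D.action (0, 0), _, ⟨(0, 0), D.zero_mem_slopes, rfl⟩, by rintro _ rfl; exact le_rfl⟩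
  have hlow : ∀ x : ℝ × C(Icc (0 : ℝ) T, ℝ), x.2 ∈ D.slopes →
      D.levelAtInfinity ≤ D.action x := fun x hx => by
    rw [← hinf]
    exact csInf_le hbdd₁ ⟨_, ⟨x, hx, rfl⟩, by rintro _ rfl; exact le_rfl⟩
  -- so is the minimax level of the crossing paths
  have hne : {r | ∃ A ∈ D.crossingPaths, ∀ x ∈ A, D.action x ≤ r}.Nonempty := by
    obtain ⟨B, hB⟩ := D.exists_bound_F
    refine ⟨D.energy (prim T D.h) 0 + T * B, _, ⟨fun s => (s, 0), by fun_prop,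
      fun _ => D.zero_mem_slopes, tendsto_id, tendsto_id, rfl⟩, ?_⟩
    rintro _ ⟨s, rfl⟩
    have := (abs_le.1 (D.abs_total_F_le hB (trajectory (s, 0)))).2
    unfold action
    linarith
  have hcross : sInf {r | ∃ A ∈ D.crossingPaths, ∀ x ∈ A, D.action x ≤ r}
      = D.levelAtInfinity := by
    by_contra hc
    refine hno (D.exists_gap_eq_zero_of_minimax _ ?_
      (fun A hA l h0 h1 => D.step_image_mem_crossingPaths hA h0 h1) ⟨m, ?_⟩ hne hc)
    · rintro _ ⟨γ, -, hs, -, -, rfl⟩ _ ⟨s, rfl⟩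
      exact hs s
    · rintro r ⟨_, ⟨γ, -, hs, -, -, rfl⟩, hr⟩
      exact (hm _ (hs 0)).trans (hr _ ⟨0, rfl⟩)
  -- hence states with initial value zero approach the infimum, and a descent step goes below it
  obtain ⟨δ, hδ, hgap⟩ := D.exists_gap_ge (fun x hx h => hno ⟨x, hx, h⟩) le_rfl
  obtain ⟨l, hl, hl1, hdesc⟩ := D.action_step_le (half_pos hδ)
  have hlδ : 0 < l * δ := by positivity
  obtain ⟨r, ⟨_, ⟨γ, hγ, hs, htop, hbot, rfl⟩, hr⟩, hlt⟩ := exists_lt_of_csInf_lt hne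
    (show _ < D.levelAtInfinity + l * δ / 2 by rw [hcross]; linarith)
  obtain ⟨s, hs0⟩ := (continuous_fst.comp hγ).surjective htop hbot 0
  have h1 := hr (γ s) ⟨s, rfl⟩
  have h2 := hdesc (γ s) (hs s)
  have h3 := mul_le_mul_of_nonneg_left (hgap (γ s) (hs s) (by
    change |(Prod.fst ∘ γ) s| ≤ 0
    rw [hs0, abs_zero])) hl.le
  have h4 := hlow _ (D.step_mem hl.le hl1 (hs s))
  linarith

/-- At a critical state `φ(u')` is the primitive of the right-hand side up to a constant, and takes
the same values at both ends. -/
theorem exists_critical : ∃ (r c : ℝ) (p : C(Icc (0 : ℝ) T, ℝ)), total T p = 0 ∧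
    total T (superpose D.f (trajectory (r, p))) = 0 ∧
    (∀ t, p t ∈ Icc (D.θ (-D.M)) (D.θ D.M)) ∧
    ∀ t, p t = D.θ (c + prim T (superpose D.f (trajectory (r, p)) + D.h) t) := by
  obtain ⟨⟨r, p⟩, hp, h⟩ := D.exists_gap_eq_zero
  have h1 := D.energy_slope_le (D.norm_load_le (r, p)) hp.1
  have h2 := sq_nonneg (D.drift (r, p))
  unfold gap at h
  have h3 : D.drift (r, p) ^ 2 = 0 := by linarith
  have h4 := D.eq_slope_of_energy_eq (D.norm_load_le (r, p)) hp.1 hp.2.1 (by linarith)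
  refine ⟨r, D.shift (D.load (r, p)), p, hp.1, pow_eq_zero_iff two_ne_zero |>.1 h3, hp.2.1,
    fun t => ?_⟩
  exact congrArg (fun q : C(Icc (0 : ℝ) T, ℝ) => q t) h4

end ResonantProblem

/-! ### Regularization of the singular operator -/

/-- The homeomorphism `Φ' : (-a, a) → ℝ`. -/
noncomputable def HypPhi.homeo {a : ℝ} {Φ : ℝ → ℝ} (hΦ : HypPhi a Φ) : Ioo (-a) a ≃ₜ ℝ :=
  hΦ.isHomeomorph.homeomorph _

/-- The inverse of `Φ'`, with values in `(-a, a)`. -/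
noncomputable def HypPhi.inv {a : ℝ} {Φ : ℝ → ℝ} (hΦ : HypPhi a Φ) : C(ℝ, ℝ) where
  toFun y := hΦ.homeo.symm y
  continuous_toFun := continuous_subtype_val.comp hΦ.homeo.symm.continuous

theorem HypPhi.inv_mem {a : ℝ} {Φ : ℝ → ℝ} (hΦ : HypPhi a Φ) (y : ℝ) :
    hΦ.inv y ∈ Ioo (-a) a := (hΦ.homeo.symm y).2

theorem HypPhi.deriv_inv {a : ℝ} {Φ : ℝ → ℝ} (hΦ : HypPhi a Φ) (y : ℝ) :
    deriv Φ (hΦ.inv y) = y := hΦ.homeo.apply_symm_apply y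

theorem HypPhi.inv_strictMono {a : ℝ} {Φ : ℝ → ℝ} (hΦ : HypPhi a Φ) : StrictMono hΦ.inv :=
  fun y z hyz => by
    rwa [← hΦ.strictMonoOn.lt_iff_lt (hΦ.inv_mem y) (hΦ.inv_mem z), hΦ.deriv_inv, hΦ.deriv_inv]

theorem HypPhi.inv_zero {a : ℝ} {Φ : ℝ → ℝ} (ha : 0 < a) (hΦ : HypPhi a Φ) : hΦ.inv 0 = 0 :=
  hΦ.strictMonoOn.injOn (hΦ.inv_mem 0) ⟨neg_lt_zero.2 ha, ha⟩
    (by rw [hΦ.deriv_inv, hΦ.map_zero])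

theorem HypPhi.inv_neg_le_inv {a M : ℝ} {Φ : ℝ → ℝ} (hΦ : HypPhi a Φ) (hM : 0 ≤ M) :
    hΦ.inv (-M) ≤ hΦ.inv M :=
  hΦ.inv_strictMono.monotone (neg_le_self hM)

/-- The function `Φ'` restricted to the values of modulus at most `M`, extended by constants. -/
noncomputable def HypPhi.reg {a M : ℝ} {Φ : ℝ → ℝ} (hΦ : HypPhi a Φ) (hM : 0 ≤ M) : C(ℝ, ℝ) where
  toFun := IccExtend (hΦ.inv_neg_le_inv hM) fun x => deriv Φ x
  continuous_toFun := by
    refine Continuous.Icc_extend' (f := fun x : Icc (hΦ.inv (-M)) (hΦ.inv M) => deriv Φ x) ?_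
    exact hΦ.homeo.continuous.comp (continuous_subtype_val.subtype_mk fun x =>
      ⟨(hΦ.inv_mem _).1.trans_le x.2.1, x.2.2.trans_lt (hΦ.inv_mem _).2⟩)

theorem HypPhi.reg_eq {a M : ℝ} {Φ : ℝ → ℝ} (hΦ : HypPhi a Φ) (hM : 0 ≤ M) {x : ℝ}
    (hx : x ∈ Icc (hΦ.inv (-M)) (hΦ.inv M)) : hΦ.reg hM x = deriv Φ x :=
  IccExtend_of_mem (hΦ.inv_neg_le_inv hM)
    (fun x : Icc (hΦ.inv (-M)) (hΦ.inv M) => deriv Φ x) hx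

theorem HypPhi.Icc_inv_subset {a M : ℝ} {Φ : ℝ → ℝ} (hΦ : HypPhi a Φ) :
    Icc (hΦ.inv (-M)) (hΦ.inv M) ⊆ Ioo (-a) a := fun _ hx =>
  ⟨(hΦ.inv_mem _).1.trans_le hx.1, hx.2.trans_lt (hΦ.inv_mem _).2⟩

theorem HypPhi.reg_monotone {a M : ℝ} {Φ : ℝ → ℝ} (hΦ : HypPhi a Φ) (hM : 0 ≤ M) :
    Monotone (hΦ.reg hM) :=
  Monotone.IccExtend (f := fun x : Icc (hΦ.inv (-M)) (hΦ.inv M) => deriv Φ x) _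
    fun x y hxy => hΦ.strictMonoOn.monotoneOn
      (hΦ.Icc_inv_subset x.2) (hΦ.Icc_inv_subset y.2) hxy

theorem HypPhi.reg_injOn {a M : ℝ} {Φ : ℝ → ℝ} (hΦ : HypPhi a Φ) (hM : 0 ≤ M) :
    InjOn (hΦ.reg hM) (Icc (hΦ.inv (-M)) (hΦ.inv M)) := fun x hx y hy hxy => by
  rw [hΦ.reg_eq hM hx, hΦ.reg_eq hM hy] at hxy
  exact hΦ.strictMonoOn.injOn (hΦ.Icc_inv_subset hx) (hΦ.Icc_inv_subset hy) hxy

theorem HypPhi.reg_inv {a M : ℝ} {Φ : ℝ → ℝ} (hΦ : HypPhi a Φ) (hM : 0 ≤ M) {y : ℝ}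
    (hy : |y| ≤ M) : hΦ.reg hM (hΦ.inv y) = y := by
  rw [hΦ.reg_eq hM ⟨hΦ.inv_strictMono.monotone (abs_le.1 hy).1,
    hΦ.inv_strictMono.monotone (abs_le.1 hy).2⟩, hΦ.deriv_inv]

/-! ### Strongly resonant nonlinearities -/

theorem exists_forall_of_tendstoUniformlyOn {T c : ℝ} {g : ℝ → ℝ → ℝ}
    (h : TendstoUniformlyOn (fun s t => g t s) (fun _ => c) (comap (fun s : ℝ => |s|) atTop)
      (Icc 0 T)) {ε : ℝ} (hε : 0 < ε) :
    ∃ R, ∀ (t : Icc (0 : ℝ) T) (s : ℝ), R ≤ |s| → |g t s - c| ≤ ε := by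
  have h1 := Metric.tendstoUniformlyOn_iff.1 h ε hε
  rw [eventually_comap, eventually_atTop] at h1
  obtain ⟨R, hR⟩ := h1
  refine ⟨R, fun t s hs => ?_⟩
  have := hR _ hs s rfl t t.2
  rw [dist_comm, Real.dist_eq] at this
  exact this.le

/-- The nonlinearity as a continuous function on `[0, T] × ℝ`. -/
def StrongResonance.toMap {T : ℝ} {f : ℝ → ℝ → ℝ} (hf : StrongResonance T f) :
    C(Icc (0 : ℝ) T × ℝ, ℝ) where
  toFun z := f z.1 z.2
  continuous_toFun := hf.continuousOn.comp_continuous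
    (f := fun z : Icc (0 : ℝ) T × ℝ => ((z.1 : ℝ), z.2)) (by fun_prop) fun z => ⟨z.1.2, mem_univ _⟩

/-- The primitive of the nonlinearity as a continuous function on `[0, T] × ℝ`. -/
noncomputable def StrongResonance.primMap {T : ℝ} {f : ℝ → ℝ → ℝ} (hf : StrongResonance T f) :
    C(Icc (0 : ℝ) T × ℝ, ℝ) where
  toFun z := primitive f z.1 z.2
  continuous_toFun := intervalIntegral.continuous_parametric_primitive_of_continuous
    (f := fun (t : Icc (0 : ℝ) T) s => f t s) hf.toMap.continuous

theorem StrongResonance.uniform {T : ℝ} {f : ℝ → ℝ → ℝ} (hf : StrongResonance T f) {ε : ℝ}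
    (hε : 0 < ε) : ∃ δ > 0, ∀ t s s', |s' - s| ≤ δ → |hf.toMap (t, s') - hf.toMap (t, s)| ≤ ε := by
  have hlim : Tendsto hf.toMap (cocompact _) (𝓝 0) := by
    refine Metric.tendsto_nhds.2 fun η hη => ?_
    obtain ⟨R, hR⟩ := exists_forall_of_tendstoUniformlyOn hf.tendsto_zero (half_pos hη)
    refine mem_cocompact.2 ⟨univ ×ˢ Icc (-R) R, isCompact_univ.prod isCompact_Icc, ?_⟩
    rintro ⟨t, s⟩ hz
    have hs : R ≤ |s| := by
      by_contra! hs
      exact hz ⟨mem_univ _, abs_le.1 hs.le⟩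
    exact lt_of_le_of_lt (hR t s hs) (half_lt_self hη)
  obtain ⟨δ, hδ, h⟩ := Metric.uniformContinuous_iff.1
    (hf.toMap.continuous.uniformContinuous_of_tendsto_cocompact hlim) ε hε
  refine ⟨δ / 2, half_pos hδ, fun t s s' hs => (h (?_ : dist (t, s') (t, s) < δ)).le⟩
  rw [Prod.dist_eq, dist_self, Real.dist_eq]
  exact max_lt hδ (by linarith)

/-! ### Solutions from critical states -/

/-- Replacing `Φ'` by its regularization at a level above the a priori bound for the values of
`Φ'(u')` gives a problem of the regularized kind, with the same inverse operator. -/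
theorem exists_resonantProblem {a T : ℝ} [hT : Fact (0 < T)] {Φ : ℝ → ℝ} {f : ℝ → ℝ → ℝ}
    (ha : 0 < a) (hΦ : HypPhi a Φ) (hf : StrongResonance T f) (h : C(Icc (0 : ℝ) T, ℝ)) :
    ∃ D : ResonantProblem T, D.θ = hΦ.inv ∧ D.f = hf.toMap ∧ D.h = h := by
  obtain ⟨B, hB⟩ := exists_bound_of_bound_far (g := hf.toMap) (c := 0)
    (exists_forall_of_tendstoUniformlyOn hf.tendsto_zero one_pos)
  obtain ⟨α, hα⟩ := hf.tendsto_primitive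
  have hB0 : 0 ≤ B := (abs_nonneg _).trans (hB (⟨0, left_mem_Icc.2 hT.out.le⟩, 0))
  have hL : 0 < B + ‖h‖ + 1 := by positivity
  have hM : 0 ≤ 2 * T * (B + ‖h‖ + 1) := by have := hT.out; positivity
  exact ⟨{
    θ := hΦ.inv
    φ := hΦ.reg hM
    f := hf.toMap
    F := hf.primMap
    h := h
    L := B + ‖h‖ + 1
    α := α
    L_pos := hL
    θ_strictMono := hΦ.inv_strictMono
    θ_zero := hΦ.inv_zero ha
    φ_mono := hΦ.reg_monotone hM
    φ_θ := fun y hy => hΦ.reg_inv hM hy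
    φ_injOn := hΦ.reg_injOn hM
    bound := fun z => by linarith [hB z]
    f_unif := fun ε hε => hf.uniform hε
    f_zero := fun ε hε => by
      obtain ⟨R, hR⟩ := exists_forall_of_tendstoUniformlyOn hf.tendsto_zero hε
      refine ⟨R, fun t s hs => ?_⟩
      rw [← sub_zero (hf.toMap (t, s))]
      exact hR t s hs
    hasDerivAt_F := fun t s =>
      ((hf.toMap.continuous.comp (Continuous.prodMk_right t)).integral_hasStrictDerivAt 0
        s).hasDerivAt
    F_lim := fun ε hε => exists_forall_of_tendstoUniformlyOn hα hε }, rfl, rfl, rfl⟩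

theorem exists_isPeriodicSolution {a T : ℝ} {Φ : ℝ → ℝ} {f : ℝ → ℝ → ℝ} {h : ℝ → ℝ}
    (ha : 0 < a) (hT : 0 < T) (hΦ : HypPhi a Φ) (hf : StrongResonance T f)
    (hh : ContinuousOn h (Icc 0 T)) (hh0 : (∫ t in (0 : ℝ)..T, h t) = 0) :
    ∃ u : ℝ → ℝ, IsPeriodicSolution a T Φ f h u := by
  have : Fact (0 < T) := ⟨hT⟩
  let h' : C(Icc (0 : ℝ) T, ℝ) := ⟨fun t => h t, hh.domRestrict⟩
  have hh' : total T h' = 0 := by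
    have hcongr : EqOn (extendConst h') h (uIcc 0 T) := fun t ht => by
      rw [uIcc_of_le hT.le] at ht
      exact extendConst_apply h' ⟨t, ht⟩
    exact (intervalIntegral.integral_congr hcongr).trans hh0
  obtain ⟨D, hDθ, hDf, hDh⟩ := exists_resonantProblem ha hΦ hf h'
  obtain ⟨r, c, p, hp0, hdrift, hpI, hp⟩ := D.exists_critical
  set e := ResonantProblem.superpose D.f (ResonantProblem.trajectory (r, p)) + D.h with he
  have he0 : total T e = 0 := by rw [he, map_add, hdrift, hDh, hh', add_zero]
  let u : ℝ → ℝ := fun t => r + ∫ s in (0 : ℝ)..t, extendConst p s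
  let Q : ℝ → ℝ := fun t => c + ∫ s in (0 : ℝ)..t, extendConst e s
  have hu : ∀ t, HasDerivAt u (extendConst p t) t := fun t =>
    (hasDerivAt_integral_extendConst p t).const_add r
  have hQ : ∀ t, HasDerivAt Q (extendConst e t) t := fun t =>
    (hasDerivAt_integral_extendConst e t).const_add c
  have hud : ∀ t (ht : t ∈ Icc 0 T), derivWithin u (Icc 0 T) t = p ⟨t, ht⟩ := fun t ht => by
    rw [(hu t).hasDerivWithinAt.derivWithin (uniqueDiffOn_Icc hT t ht)]
    exact extendConst_apply p ⟨t, ht⟩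
  have hpQ : ∀ t (ht : t ∈ Icc 0 T), p ⟨t, ht⟩ = hΦ.inv (Q t) := fun t ht => by
    rw [hp, hDθ]
    rfl
  have hφQ : EqOn (fun t => deriv Φ (derivWithin u (Icc 0 T) t)) Q (Icc 0 T) := fun t ht => by
    simp only [hud t ht, hpQ t ht, hΦ.deriv_inv]
  have hsmooth : ∀ {v : ℝ → ℝ} {q : C(Icc (0 : ℝ) T, ℝ)},
      (∀ t, HasDerivAt v (extendConst q t) t) → ContDiff ℝ 1 v := fun {v q} hv =>
    contDiff_one_iff_deriv.2 ⟨fun t => (hv t).differentiableAt, by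
      rw [funext fun t => (hv t).deriv]
      exact continuous_extendConst q⟩
  have h0 : (0 : ℝ) ∈ Icc 0 T := left_mem_Icc.2 hT.le
  have hTT : T ∈ Icc 0 T := right_mem_Icc.2 hT.le
  refine ⟨u, (hsmooth hu).contDiffOn, ?_, ?_, ?_, ?_, ?_⟩
  · simp only [u, ← total_apply, hp0, intervalIntegral.integral_same]
  · rw [hud 0 h0, hud T hTT, hpQ, hpQ]
    simp only [Q, ← total_apply, he0, intervalIntegral.integral_same]
  · refine ⟨max |D.θ (-D.M)| |D.θ D.M|, max_lt ?_ ?_, fun t ht => ?_⟩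
    · rw [hDθ]
      exact abs_lt.2 (hΦ.inv_mem _)
    · rw [hDθ]
      exact abs_lt.2 (hΦ.inv_mem _)
    · rw [hud t ht]
      exact abs_le_max_abs_abs (hpI _).1 (hpI _).2
  · refine ContDiffOn.absolutelyContinuousOnInterval ?_
    rw [uIcc_of_le hT.le]
    exact (hsmooth hQ).contDiffOn.congr hφQ
  · refine ae_restrict_of_forall_mem measurableSet_Ioo fun t ht => ?_
    have htI := Ioo_subset_Icc_self ht
    have hval : extendConst e t = f t (u t) + h t := by
      rw [extendConst_apply e ⟨t, htI⟩, he, hDf, hDh]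
      rfl
    rw [← hval]
    exact (hQ t).congr_of_eventuallyEq
      (hφQ.eventuallyEq_of_mem (Icc_mem_nhds ht.1 ht.2))

/-! ### The relativistic operator -/

theorem one_sub_sq_pos {s : ℝ} (hs : s ∈ Ioo (-1 : ℝ) 1) : 0 < 1 - s ^ 2 := by
  nlinarith [hs.1, hs.2]

theorem hasDerivAt_relativistic {s : ℝ} (hs : s ∈ Ioo (-1 : ℝ) 1) :
    HasDerivAt (fun s : ℝ => 1 - √(1 - s ^ 2)) (s / √(1 - s ^ 2)) s := by
  have h := one_sub_sq_pos hs
  have h1 : HasDerivAt (fun s : ℝ => 1 - s ^ 2) (-(2 * s)) s := by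
    simpa using (hasDerivAt_pow 2 s).const_sub 1
  have h2 : s / √(1 - s ^ 2) = -(-(2 * s) / (2 * √(1 - s ^ 2))) := by
    have := Real.sqrt_pos.2 h
    field_simp
  rw [h2]
  exact (h1.sqrt h.ne').const_sub 1

theorem deriv_relativistic {s : ℝ} (hs : s ∈ Ioo (-1 : ℝ) 1) :
    deriv (fun s : ℝ => 1 - √(1 - s ^ 2)) s = s / √(1 - s ^ 2) :=
  (hasDerivAt_relativistic hs).deriv

theorem div_sqrt_one_add_sq_mem (y : ℝ) : y / √(1 + y ^ 2) ∈ Ioo (-1 : ℝ) 1 := by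
  have h : |y| < √(1 + y ^ 2) := Real.lt_sqrt_of_sq_lt (by rw [sq_abs]; linarith)
  have h0 : 0 < √(1 + y ^ 2) := (abs_nonneg y).trans_lt h
  refine abs_lt.1 ?_
  rwa [abs_div, abs_of_pos h0, div_lt_one h0]

/-- The homeomorphism `s ↦ s / √(1 - s²)` of `(-1, 1)` onto the line, with inverse
`y ↦ y / √(1 + y²)`. -/
noncomputable def relativisticHomeo : Ioo (-1 : ℝ) 1 ≃ₜ ℝ where
  toFun s := s / √(1 - (s : ℝ) ^ 2)
  invFun y := ⟨y / √(1 + y ^ 2), div_sqrt_one_add_sq_mem y⟩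
  left_inv s := by
    have h := one_sub_sq_pos s.2
    ext
    have h1 : 1 + ((s : ℝ) / √(1 - (s : ℝ) ^ 2)) ^ 2 = (1 - (s : ℝ) ^ 2)⁻¹ := by
      rw [div_pow, Real.sq_sqrt h.le]
      field_simp
      ring
    have := Real.sqrt_pos.2 h
    simp only [h1, Real.sqrt_inv]
    field_simp
  right_inv y := by
    have h : 0 < 1 + y ^ 2 := by positivity
    have h1 : 1 - (y / √(1 + y ^ 2)) ^ 2 = (1 + y ^ 2)⁻¹ := by
      rw [div_pow, Real.sq_sqrt h.le]
      field_simp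
      ring
    have := Real.sqrt_pos.2 h
    simp only [h1, Real.sqrt_inv]
    field_simp
  continuous_toFun := by
    refine Continuous.div (by fun_prop) (by fun_prop) fun s => ?_
    exact (Real.sqrt_pos.2 (one_sub_sq_pos s.2)).ne'
  continuous_invFun := by
    refine Continuous.subtype_mk (Continuous.div (by fun_prop) (by fun_prop) fun y => ?_) _
    exact (Real.sqrt_pos.2 (by positivity)).ne'

theorem hypPhi_relativistic : HypPhi 1 (fun s => 1 - √(1 - s ^ 2)) where
  continuousOn := by fun_prop
  contDiffOn := fun s hs => by
    refine ContDiffAt.contDiffWithinAt (contDiffAt_const.sub (ContDiffAt.sqrt ?_ ?_))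
    · fun_prop
    · exact (one_sub_sq_pos hs).ne'
  strictMonoOn := by
    intro s hs t ht hst
    have h1 := one_sub_sq_pos hs
    have h2 := one_sub_sq_pos ht
    have h3 := Real.sqrt_pos.2 h1
    have h4 := Real.sqrt_pos.2 h2
    rw [deriv_relativistic hs, deriv_relativistic ht, div_lt_div_iff₀ h3 h4]
    rcases le_or_gt 0 s with hs0 | hs0
    · have h5 : √(1 - t ^ 2) ≤ √(1 - s ^ 2) := Real.sqrt_le_sqrt (by nlinarith)
      exact (mul_le_mul_of_nonneg_left h5 hs0).trans_lt (mul_lt_mul_of_pos_right hst h3)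
    rcases le_or_gt t 0 with ht0 | ht0
    · have h5 : √(1 - s ^ 2) ≤ √(1 - t ^ 2) := Real.sqrt_le_sqrt (by nlinarith)
      exact (mul_lt_mul_of_pos_right hst h4).trans_le (mul_le_mul_of_nonpos_left h5 ht0)
    · exact (mul_neg_of_neg_of_pos hs0 h4).trans (mul_pos ht0 h3)
  isHomeomorph := by
    have : (Ioo (-1 : ℝ) 1).domRestrict (deriv fun s : ℝ => 1 - √(1 - s ^ 2)) =
        relativisticHomeo := funext fun s => deriv_relativistic s.2
    rw [this]
    exact relativisticHomeo.isHomeomorph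
  map_zero := by
    rw [deriv_relativistic (by norm_num), zero_div]

theorem theorem2p2 :
    (∀ (a T : ℝ) (Φ : ℝ → ℝ) (f : ℝ → ℝ → ℝ) (h : ℝ → ℝ), 0 < a → 0 < T →
      HypPhi a Φ → StrongResonance T f →
      ContinuousOn h (Icc 0 T) → (∫ t in (0 : ℝ)..T, h t) = 0 →
      ∃ u : ℝ → ℝ, IsPeriodicSolution a T Φ f h u) ∧
    (HypPhi 1 (fun s => 1 - √(1 - s ^ 2)) ∧
      ∀ s ∈ Ioo (-1 : ℝ) 1, deriv (fun s : ℝ => 1 - √(1 - s ^ 2)) s = s / √(1 - s ^ 2)) :=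
  ⟨fun _ _ _ _ _ ha hT hΦ hf hh hh0 => exists_isPeriodicSolution ha hT hΦ hf hh hh0,
    hypPhi_relativistic, fun _ hs => deriv_relativistic hs⟩
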